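/- Let $m\ge 0$ and let $F$ be the free Lie ring (Lie algebra over $\mathbb Z$) on $X_1,\dots,X_m$. Write $\gamma_1(F)=F$, $\gamma_{n+1}(F)=[F,\gamma_n(F)]$ for its lower central series, $U(F)$ for its universal enveloping ring, into which $F$ embeds, and $\varpi$ for the augmentation ideal of $U(F)$, that is, the two-sided ideal generated by $F$. Let $e_1\mid e_2\mid\cdots\mid e_m$ be integers $\ge 0$, let $\xi_1,\dots,\xi_m\in\gamma_2(F)$, and let $S\subseteq\gamma_2(F)$ be a (finite or infinite) set of further elements. Let $R$ be the Lie ideal of $F$ generated by $e_1X_1+\xi_1,\dots,e_mX_m+\xi_m$ and $S$ (so that $L=F/R$ is given by a preabelian presentation), and let $\mathfrak r$ be the two-sided ideal of $U(F)$ generated by $R$. Then the Lie subring $(\varpi^4+\mathfrak r)\cap F$ of $F$ consists, modulo $\gamma_4(F)+R$, of all elements $$\sum_{i>j}a_{ij}[X_i,X_j],\qquad a_{ij}\in\mathbb Z\quad(1\le j<i\le m),$$ such that $e_i\mid a_{ij}$ for all $i>j$ and, for every $i\in\{1,\dots,m\}$, $$W_i:=\sum_{j<i}a_{ij}X_j-\sum_{j>i}a_{ji}X_j\in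 e_i\gamma_2(F)+\gamma_3(F)+R.$$ That is, an element $w\in F$ lies in $\varpi^4+\mathfrak r$ if and only if there are integers $a_{ij}$ $(i>j)$ satisfying these two conditions with $w-\sum_{i>j}a_{ij}[X_i,X_j]\in\gamma_4(F)+R$. -/

import Mathlib

open scoped Pointwise

attribute [local instance 100] LieRing.ofAssociativeRing

noncomputable section

namespace LieDim

/-- The term `γ_n(L)`, `n ≥ 1`, of the lower central series of a Lie ring:
`γ_1(L) = L` and `γ_{n+1}(L) = [L, γ_n(L)]`. (Mathlib numbers the terms from `0`.) -/
def gamma (L : Type*) [LieRing L] (n : ℕ) : LieIdeal ℤ L :=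
  LieModule.lowerCentralSeries ℤ L L (n - 1)

/-- The free Lie ring on `X_1, …, X_m`. -/
abbrev F (m : ℕ) : Type := FreeLieAlgebra ℤ (Fin m)

/-- The free generators. -/
abbrev X {m : ℕ} (i : Fin m) : F m := FreeLieAlgebra.of ℤ i

/-- The universal enveloping ring `U(L)` of a Lie ring. -/
abbrev U (L : Type*) [LieRing L] : Type _ := UniversalEnvelopingAlgebra ℤ L

/-- The two-sided ideal of `U(L)` generated by (the image of) a subset of `L`. -/
def envIdeal (L : Type*) [LieRing L] (s : Set L) : Ideal (U L) :=
  (TwoSidedIdeal.span (UniversalEnvelopingAlgebra.ι ℤ '' s : Set (U L))).asIdeal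

/-- The augmentation ideal `ϖ(L)`: the two-sided ideal of `U(L)` generated by `L`. -/
def augIdeal (L : Type*) [LieRing L] : Ideal (U L) :=
  envIdeal L Set.univ

/-- The Lie subring `I ∩ L` of `L` cut out by an ideal `I` of `U(L)`, that is,
the preimage of `I` under the natural map `L → U(L)` (which is injective for free `L`). -/
def interLie (L : Type*) [LieRing L] (I : Ideal (U L)) : LieSubalgebra ℤ L where
  carrier := {w | UniversalEnvelopingAlgebra.ι ℤ w ∈ I}
  add_mem' {a b} ha hb := by
    change UniversalEnvelopingAlgebra.ι ℤ (a + b) ∈ I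
    rw [map_add]
    exact I.add_mem ha hb
  zero_mem' := by
    change UniversalEnvelopingAlgebra.ι ℤ (0 : L) ∈ I
    rw [map_zero]
    exact I.zero_mem
  smul_mem' c a ha := by
    change UniversalEnvelopingAlgebra.ι ℤ (c • a) ∈ I
    rw [map_zsmul]
    exact zsmul_mem ha c
  lie_mem' {a b} ha hb := by
    change UniversalEnvelopingAlgebra.ι ℤ ⁅a, b⁆ ∈ I
    rw [LieHom.map_lie, LieRing.of_associative_ring_bracket]
    exact I.sub_mem (I.mul_mem_left _ hb) (I.mul_mem_left _ ha)

/-- The ideal `R` of the free Lie ring generated by the relators `e_i X_i + ξ_i`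
(`1 ≤ i ≤ m`) together with the further relators in `S`. -/
def relIdeal {m : ℕ} (e : Fin m → ℕ) (ξ : Fin m → F m) (S : Set (F m)) : LieIdeal ℤ (F m) :=
  LieSubmodule.lieSpan ℤ (F m) (Set.range (fun i => (e i : ℤ) • X i + ξ i) ∪ S)

/-- The element `∑_{i > j} a_{ij} [X_i, X_j]`. -/
def commSum {m : ℕ} (a : Fin m → Fin m → ℤ) : F m :=
  ∑ i, ∑ j ∈ Finset.Iio i, a i j • ⁅X i, X j⁆

/-- The element `W_i = ∑_{j < i} a_{ij} X_j - ∑_{j > i} a_{ji} X_j`. -/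
def W {m : ℕ} (a : Fin m → Fin m → ℤ) (i : Fin m) : F m :=
  ∑ j ∈ Finset.Iio i, a i j • X j - ∑ j ∈ Finset.Ioi i, a j i • X j

end LieDim

end

noncomputable section

namespace LieDim

/-! Sufficiency rests on the identity `∑ a_ij [X_i, X_j] = ∑ X_i W_i` in `U(F)` (`ι_commSum`). If `u
∈ γ_2`, then `X_i · e_i u = (e_i X_i + ξ_i) u - ξ_i u` lies in `𝔯 + ϖ^4`; the `γ_3` and `R` parts of
`W_i` are absorbed directly (`x_mul_ι_mem_of_mem`).

For necessity, `𝔯` is the left ideal generated by `R`, and linear coefficients of relations at `X_k`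
are divisible by `e_k`. Hence `w ≡ r_0 + ∑ X_i r_i` with `r_0, r_i ∈ R`, up to terms of degree at
least 4 and cubic terms whose `X_i X_j X_k` coefficient is divisible by `e_k` (`mem_approx`). Put `v
= w - r_0` and compare coefficients of words. Degree 1 gives `v ∈ γ_2`. Degree 2 gives `v ≡ ∑ a_ij
[X_i, X_j]` modulo `γ_3`, where `W_i` is the linear part of `r_i`; this yields `e_i ∣ a_ij`. In
degree 3, let `g` be the cubic part of `v` beyond the commutator sum, written in basic commutators.
Its coefficients agree, modulo `e_k`, with the quadratic part `d_i` of `r_i`, which is alternating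
in `j, k`. Symmetrizing kills `d_i` and isolates the coefficient of `[[X_i, X_j], X_k]`, so `e_j`
divides it (`dualForm_basic₃`, `dvd_dualForm`). Therefore `g ∈ γ_4 + R`; feeding this divisibility
back into the congruence for `d_i` gives the condition on `W_i`. -/

open UniversalEnvelopingAlgebra (ι)

/-! ### Generation by the letters. -/

variable {m : ℕ}

/-- A Lie subalgebra of the free Lie ring containing the generators is everything. -/
theorem lieSubalgebra_eq_top {K : LieSubalgebra ℤ (F m)} (h : ∀ i, X i ∈ K) (w : F m) : w ∈ K := by
  let f : F m →ₗ⁅ℤ⁆ K := FreeLieAlgebra.lift ℤ fun i => ⟨X i, h i⟩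
  have hf : K.incl.comp f = LieHom.id := FreeLieAlgebra.hom_ext fun i =>
    congrArg Subtype.val (FreeLieAlgebra.lift_of_apply (R := ℤ) (fun i => (⟨X i, h i⟩ : K)) i)
  have := LieHom.congr_fun hf w
  rw [← LieHom.id_apply (R := ℤ) w, ← this]
  exact (f w).2

/-- The image of a generator in the enveloping ring. -/
def x (i : Fin m) : U (F m) := ι ℤ (X i)

theorem ι_lie {L : Type*} [LieRing L] (u v : L) :
    (ι ℤ ⁅u, v⁆ : U L) = ι ℤ u * ι ℤ v - ι ℤ v * ι ℤ u := by
  rw [LieHom.map_lie, LieRing.of_associative_ring_bracket]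

/-- The subalgebra `B` contains the image of `F`, so the universal property gives a map `U(F) → B`
which, followed by the inclusion, is the identity. -/
theorem adjoin_range_x : Algebra.adjoin ℤ (Set.range (x : Fin m → U (F m))) = ⊤ := by
  set B := Algebra.adjoin ℤ (Set.range (x : Fin m → U (F m))) with hB
  have hι : ∀ w : F m, ι ℤ w ∈ B := by
    let K : LieSubalgebra ℤ (F m) :=
      { B.toSubmodule.comap (ι ℤ : F m →ₗ⁅ℤ⁆ U (F m)).toLinearMap with
        lie_mem' := fun {u v} hu hv => by
          change ι ℤ ⁅u, v⁆ ∈ B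
          rw [ι_lie]
          exact B.sub_mem (B.mul_mem hu hv) (B.mul_mem hv hu) }
    exact lieSubalgebra_eq_top (K := K) fun i => Algebra.subset_adjoin ⟨i, rfl⟩
  let f : F m →ₗ⁅ℤ⁆ B :=
    { toFun := fun w => ⟨ι ℤ w, hι w⟩
      map_add' := fun u v => Subtype.ext (map_add _ u v)
      map_smul' := fun n u => Subtype.ext (map_smul (ι ℤ) n u)
      map_lie' := fun {u v} => Subtype.ext (ι_lie u v) }
  have hf : B.val.comp (UniversalEnvelopingAlgebra.lift ℤ f) = AlgHom.id ℤ _ := by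
    apply UniversalEnvelopingAlgebra.hom_ext
    ext w
    change ((UniversalEnvelopingAlgebra.lift ℤ f (ι ℤ (X w)) : B) : U (F m)) = ι ℤ (X w)
    exact congrArg Subtype.val (UniversalEnvelopingAlgebra.lift_ι_apply ℤ f (X w))
  rw [eq_top_iff]
  intro a _
  have := DFunLike.congr_fun hf a
  rw [← AlgHom.id_apply (R := ℤ) a, ← this]
  exact (UniversalEnvelopingAlgebra.lift ℤ f a).2

/-- An additive subgroup stable under left multiplication by the generators is a left ideal. -/
theorem mul_mem_of_x_mul_mem {T : Submodule ℤ (U (F m))} (h : ∀ i, ∀ z ∈ T, x i * z ∈ T)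
    (a : U (F m)) : ∀ z ∈ T, a * z ∈ T := by
  have ha : a ∈ Algebra.adjoin ℤ (Set.range (x : Fin m → U (F m))) := by
    rw [adjoin_range_x]; trivial
  induction ha using Algebra.adjoin_induction with
  | mem y hy => obtain ⟨i, rfl⟩ := hy; exact h i
  | algebraMap n => intro z hz; rw [← Algebra.smul_def]; exact T.smul_mem n hz
  | add a b _ _ ha hb => intro z hz; rw [add_mul]; exact T.add_mem (ha z hz) (hb z hz)
  | mul a b _ _ ha hb => intro z hz; rw [mul_assoc]; exact ha _ (hb z hz)

theorem mem_of_mem_mul_x {T : Submodule ℤ (U (F m))} (h : ∀ i, ∀ z ∈ T, z * x i ∈ T)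
    (a : U (F m)) : ∀ z ∈ T, z * a ∈ T := by
  have ha : a ∈ Algebra.adjoin ℤ (Set.range (x : Fin m → U (F m))) := by
    rw [adjoin_range_x]; trivial
  induction ha using Algebra.adjoin_induction with
  | mem y hy => obtain ⟨i, rfl⟩ := hy; exact h i
  | algebraMap n =>
    intro z hz; rw [← Algebra.commutes, ← Algebra.smul_def]; exact T.smul_mem n hz
  | add a b _ _ ha hb => intro z hz; rw [mul_add]; exact T.add_mem (ha z hz) (hb z hz)
  | mul a b _ _ ha hb => intro z hz; rw [← mul_assoc]; exact hb _ (ha z hz)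

/-! ### Ideals of the enveloping ring. -/

section envIdeal

theorem ι_mem_envIdeal {L : Type*} [LieRing L] {s : Set L} {u : L} (hu : u ∈ s) :
    ι ℤ u ∈ envIdeal L s :=
  TwoSidedIdeal.mem_asIdeal.2 (TwoSidedIdeal.subset_span ⟨u, hu, rfl⟩)

theorem mul_mem_envIdeal_right {L : Type*} [LieRing L] {s : Set L} {z : U L}
    (hz : z ∈ envIdeal L s) (a : U L) : z * a ∈ envIdeal L s :=
  TwoSidedIdeal.mem_asIdeal.2 (TwoSidedIdeal.mul_mem_right _ _ _ (TwoSidedIdeal.mem_asIdeal.1 hz))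

/-- The two-sided ideal generated by a Lie ideal is generated by it as a left ideal. -/
theorem envIdeal_eq_span (I : LieIdeal ℤ (F m)) :
    envIdeal (F m) I = Ideal.span ((fun w => ι ℤ w : F m → U (F m)) '' (I : Set (F m))) := by
  apply le_antisymm
  · intro z hz
    set J : Ideal (U (F m)) :=
      Ideal.span ((fun w => ι ℤ w : F m → U (F m)) '' (I : Set (F m))) with hJ
    have hx : ∀ i, ∀ z ∈ J.restrictScalars ℤ, z * x i ∈ J.restrictScalars ℤ := by
      intro i z hz
      change z ∈ J at hz
      change z * x i ∈ J
      induction hz using Submodule.span_induction with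
      | mem y hy =>
        obtain ⟨u, hu, rfl⟩ := hy
        -- Moving `x i` to the left costs a commutator, which stays in the Lie ideal.
        have : (ι ℤ u * x i : U (F m)) = x i * ι ℤ u + ι ℤ ⁅u, X i⁆ := by
          rw [ι_lie, x]; abel
        change ι ℤ u * x i ∈ J
        rw [this]
        refine J.add_mem (J.mul_mem_left _ (Ideal.subset_span ⟨u, hu, rfl⟩))
          (Ideal.subset_span ⟨_, ?_, rfl⟩)
        exact lie_mem_left ℤ (F m) I _ _ hu
      | zero => rw [zero_mul]; exact J.zero_mem
      | add a b _ _ ha hb => rw [add_mul]; exact J.add_mem ha hb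
      | smul c a _ ha => rw [smul_eq_mul, mul_assoc]; exact J.mul_mem_left _ ha
    have hr := mem_of_mem_mul_x hx
    have hz' := TwoSidedIdeal.mem_asIdeal.1 hz
    induction hz' using TwoSidedIdeal.span_induction with
    | mem y hy => exact Ideal.subset_span hy
    | zero => exact J.zero_mem
    | add a b _ _ ha hb =>
      exact J.add_mem (ha (TwoSidedIdeal.mem_asIdeal.2 ‹_›)) (hb (TwoSidedIdeal.mem_asIdeal.2 ‹_›))
    | neg a _ ha => exact J.neg_mem (ha (TwoSidedIdeal.mem_asIdeal.2 ‹_›))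
    | left_absorb a b _ hb => exact J.mul_mem_left _ (hb (TwoSidedIdeal.mem_asIdeal.2 ‹_›))
    | right_absorb a b _ hb => exact hr _ _ (hb (TwoSidedIdeal.mem_asIdeal.2 ‹_›))
  · rw [Ideal.span_le]
    rintro _ ⟨u, hu, rfl⟩
    exact ι_mem_envIdeal hu

end envIdeal

/-! ### The lower central series and powers of the augmentation ideal. -/

section gamma

theorem lie_mem_gamma {L : Type*} [LieRing L] {n : ℕ} (hn : 1 ≤ n) {v : L}
    (hv : v ∈ gamma L n) (u : L) : ⁅u, v⁆ ∈ gamma L (n + 1) := by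
  obtain ⟨k, rfl⟩ : ∃ k, n = k + 1 := ⟨n - 1, by omega⟩
  change ⁅u, v⁆ ∈ LieModule.lowerCentralSeries ℤ L L (k + 1)
  rw [LieModule.lowerCentralSeries_succ]
  exact LieSubmodule.lie_mem_lie (LieSubmodule.mem_top u) hv

theorem mem_gamma_one {L : Type*} [LieRing L] (u : L) : u ∈ gamma L 1 :=
  LieSubmodule.mem_top u

theorem gamma_succ_le {L : Type*} [LieRing L] {n : ℕ} (hn : 1 ≤ n) {T : Submodule ℤ L}
    (h : ∀ u : L, ∀ v ∈ gamma L n, ⁅u, v⁆ ∈ T) : ∀ w ∈ gamma L (n + 1), w ∈ T := by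
  obtain ⟨k, rfl⟩ : ∃ k, n = k + 1 := ⟨n - 1, by omega⟩
  intro w hw
  change w ∈ (LieModule.lowerCentralSeries ℤ L L (k + 1)) at hw
  rw [LieModule.lowerCentralSeries_succ, ← LieSubmodule.mem_toSubmodule,
    LieSubmodule.lieIdeal_oper_eq_linear_span'] at hw
  refine Submodule.span_le.2 ?_ hw
  rintro _ ⟨u, -, v, hv, rfl⟩
  exact h u v hv

theorem lie_gamma_two_mem {L : Type*} [LieRing L] {n : ℕ} (hn : 1 ≤ n) {u v : L}
    (hu : u ∈ gamma L 2) (hv : v ∈ gamma L n) : ⁅u, v⁆ ∈ gamma L (n + 2) := by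
  let T : Submodule ℤ L :=
    { carrier := {u | ⁅u, v⁆ ∈ gamma L (n + 2)}
      add_mem' := fun {a b} ha hb => by
        change ⁅a + b, v⁆ ∈ gamma L (n + 2)
        rw [add_lie]; exact add_mem ha hb
      zero_mem' := by change ⁅(0 : L), v⁆ ∈ gamma L (n + 2); rw [zero_lie]; exact zero_mem _
      smul_mem' := fun c a ha => by
        change ⁅c • a, v⁆ ∈ gamma L (n + 2)
        rw [smul_lie]; exact (gamma L (n + 2)).smul_mem c ha }
  refine gamma_succ_le (T := T) le_rfl (fun a b _ => ?_) u hu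
  change ⁅⁅a, b⁆, v⁆ ∈ gamma L (n + 2)
  rw [lie_lie]
  exact sub_mem (lie_mem_gamma (by omega) (lie_mem_gamma hn hv b) a)
    (lie_mem_gamma (by omega) (lie_mem_gamma hn hv a) b)

theorem ι_mem_augIdeal {L : Type*} [LieRing L] (u : L) : ι ℤ u ∈ augIdeal L :=
  ι_mem_envIdeal (Set.mem_univ u)

theorem ι_mem_augIdeal_pow {L : Type*} [LieRing L] {n : ℕ} (hn : 1 ≤ n) :
    ∀ u ∈ gamma L n, ι ℤ u ∈ augIdeal L ^ n := by
  induction n, hn using Nat.le_induction with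
  | base => intro u _; rw [Submodule.pow_one]; exact ι_mem_augIdeal u
  | succ n hn ih =>
    refine gamma_succ_le (T := ((augIdeal L ^ (n + 1)).restrictScalars ℤ).comap
      (ι ℤ : L →ₗ⁅ℤ⁆ U L).toLinearMap) hn fun u v hv => ?_
    change ι ℤ ⁅u, v⁆ ∈ augIdeal L ^ (n + 1)
    rw [ι_lie]
    refine Ideal.sub_mem _ ?_ ?_
    · rw [Submodule.pow_succ' _ (Nat.one_le_iff_ne_zero.1 hn)]; exact Submodule.mul_mem_mul (ι_mem_augIdeal u) (ih v hv)
    · rw [Submodule.pow_succ]; exact Submodule.mul_mem_mul (ih v hv) (ι_mem_augIdeal u)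

end gamma

/-! ### Coefficients of words and the degree filtration. -/

section coeff

/-- Left multiplication by the letter `j` on functions on words. -/
def shift (j : Fin m) : Module.End ℤ (List (Fin m) → ℤ) where
  toFun f
    | [] => 0
    | i :: l => if i = j then f l else 0
  map_add' f g := by
    funext l; cases l with
    | nil => simp
    | cons i l => by_cases h : i = j <;> simp [h]
  map_smul' c f := by
    funext l; cases l with
    | nil => simp
    | cons i l => by_cases h : i = j <;> simp [h]

/-- The action of the enveloping ring on functions on words. -/
def wordRep (m : ℕ) : U (F m) →ₐ[ℤ] Module.End ℤ (List (Fin m) → ℤ) :=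
  UniversalEnvelopingAlgebra.lift ℤ (FreeLieAlgebra.lift ℤ shift)

/-- The coefficient of a word in an element of the enveloping ring of the free Lie ring. -/
def coeff (l : List (Fin m)) : U (F m) →ₗ[ℤ] ℤ where
  toFun z := wordRep m z (Pi.single [] 1) l
  map_add' a b := by simp
  map_smul' c a := by simp

theorem wordRep_x (j : Fin m) : wordRep m (x j) = shift j := by
  exact (UniversalEnvelopingAlgebra.lift_ι_apply ℤ (FreeLieAlgebra.lift ℤ shift) (X j)).trans
    (FreeLieAlgebra.lift_of_apply (R := ℤ) shift j)

@[simp] theorem coeff_nil_one : coeff ([] : List (Fin m)) 1 = 1 := by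
  simp [coeff]

@[simp] theorem coeff_cons_one (i : Fin m) (l : List (Fin m)) : coeff (i :: l) 1 = 0 := by
  simp [coeff]

@[simp] theorem coeff_nil_x_mul (j : Fin m) (z : U (F m)) : coeff [] (x j * z) = 0 := by
  change wordRep m (x j * z) (Pi.single [] 1) [] = 0
  rw [map_mul, wordRep_x]; rfl

@[simp] theorem coeff_cons_x_mul (i j : Fin m) (l : List (Fin m)) (z : U (F m)) :
    coeff (i :: l) (x j * z) = if i = j then coeff l z else 0 := by
  change wordRep m (x j * z) (Pi.single [] 1) (i :: l) = _
  rw [map_mul, wordRep_x]; rfl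

@[simp] theorem coeff_nil_x (j : Fin m) : coeff [] (x j) = 0 := by
  simpa using coeff_nil_x_mul j 1

@[simp] theorem coeff_cons_x (i j : Fin m) (l : List (Fin m)) :
    coeff (i :: l) (x j) = if i = j then coeff l 1 else 0 := by
  simpa using coeff_cons_x_mul i j l 1

/-- The left ideal of elements with no words of length `< n`. -/
def order (m n : ℕ) : Ideal (U (F m)) where
  carrier := {z | ∀ l : List (Fin m), l.length < n → coeff l z = 0}
  add_mem' {a b} ha hb l hl := by rw [map_add, ha l hl, hb l hl, add_zero]
  zero_mem' l _ := map_zero _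
  smul_mem' a z hz := by
    let T : Submodule ℤ (U (F m)) :=
      { carrier := {z | ∀ l : List (Fin m), l.length < n → coeff l z = 0}
        add_mem' := fun {a b} ha hb l hl => by rw [map_add, ha l hl, hb l hl, add_zero]
        zero_mem' := fun l _ => map_zero _
        smul_mem' := fun c a ha l hl => by rw [map_smul, ha l hl, smul_zero] }
    refine mul_mem_of_x_mul_mem (T := T) (fun i z hz l hl => ?_) a z hz
    cases l with
    | nil => simp
    | cons j l =>
      rw [coeff_cons_x_mul, hz l (by simp only [List.length_cons] at hl; omega), ite_self]

theorem x_mul_mem_order {n : ℕ} {z : U (F m)} (hz : z ∈ order m n) (i : Fin m) :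
    x i * z ∈ order m (n + 1) := fun l hl => by
  cases l with
  | nil => simp
  | cons j l =>
    rw [coeff_cons_x_mul, hz l (by simpa using hl), ite_self]

theorem order_antitone {a b : ℕ} (h : a ≤ b) : order m b ≤ order m a :=
  fun _ hz l hl => hz l (hl.trans_le h)

theorem ι_mul_mem_order {n : ℕ} {z : U (F m)} (hz : z ∈ order m n) (w : F m) :
    ι ℤ w * z ∈ order m (n + 1) := by
  let K : LieSubalgebra ℤ (F m) :=
    { carrier := {w | ∀ n, ∀ z ∈ order m n, ι ℤ w * z ∈ order m (n + 1)}
      add_mem' := fun {a b} ha hb n z hz => by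
        rw [map_add, add_mul]; exact Ideal.add_mem _ (ha n z hz) (hb n z hz)
      zero_mem' := fun n z hz => by rw [map_zero, zero_mul]; exact Ideal.zero_mem _
      smul_mem' := fun c a ha n z hz => by
        rw [map_zsmul, smul_mul_assoc]; exact zsmul_mem (ha n z hz) c
      lie_mem' := fun {a b} ha hb n z hz => by
        rw [ι_lie, sub_mul, mul_assoc, mul_assoc]
        -- Each of the two products raises the order by two, one more than required.
        exact order_antitone (Nat.le_succ _)
          (Ideal.sub_mem _ (ha _ _ (hb n z hz)) (hb _ _ (ha n z hz))) }
  exact lieSubalgebra_eq_top (K := K) (fun i n z hz => x_mul_mem_order hz i) w n z hz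

theorem mul_mem_order_succ {n : ℕ} {a z : U (F m)} (ha : a ∈ augIdeal (F m))
    (hz : z ∈ order m n) : a * z ∈ order m (n + 1) := by
  -- Viewing the generating set as the Lie ideal `⊤` makes the left-ideal description available.
  change a ∈ envIdeal (F m) ((⊤ : LieIdeal ℤ (F m)) : Set (F m)) at ha
  rw [envIdeal_eq_span] at ha
  induction ha using Submodule.span_induction with
  | mem y hy => obtain ⟨u, -, rfl⟩ := hy; exact ι_mul_mem_order hz u
  | zero => rw [zero_mul]; exact Ideal.zero_mem _
  | add a b _ _ ha hb => rw [add_mul]; exact Ideal.add_mem _ ha hb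
  | smul c a _ ha => rw [smul_eq_mul, mul_assoc]; exact Ideal.mul_mem_left _ _ ha

theorem augIdeal_pow_le_order {n : ℕ} (hn : 1 ≤ n) : augIdeal (F m) ^ n ≤ order m n := by
  induction n, hn using Nat.le_induction with
  | base =>
    rw [Submodule.pow_one]
    intro a ha
    rw [← mul_one a]
    exact mul_mem_order_succ ha fun l hl => absurd hl (Nat.not_lt_zero _)
  | succ n hn ih =>
    rw [Submodule.pow_succ' _ (Nat.one_le_iff_ne_zero.1 hn)]
    exact Submodule.mul_le.2 fun a ha z hz => mul_mem_order_succ ha (ih hz)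

theorem coeff_ι_gamma {n : ℕ} (hn : 1 ≤ n) {u : F m} (hu : u ∈ gamma (F m) n)
    (l : List (Fin m)) (hl : l.length < n) : coeff l (ι ℤ u) = 0 :=
  augIdeal_pow_le_order hn (ι_mem_augIdeal_pow hn u hu) l hl

end coeff

/-! ### The identity between the commutator sum and the elements `W_i`. -/

section linear

/-- The coefficient of `X_j` in `W_i`. -/
def wCoeff (a : Fin m → Fin m → ℤ) (i j : Fin m) : ℤ :=
  if j < i then a i j else if i < j then -a j i else 0

theorem W_eq_sum (a : Fin m → Fin m → ℤ) (i : Fin m) : W a i = ∑ j, wCoeff a i j • X j := by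
  have h1 : ∑ j ∈ Finset.Iio i, a i j • X j = ∑ j, if j < i then a i j • X j else 0 := by
    rw [← Finset.sum_filter]; congr 1; ext; simp
  have h2 : ∑ j ∈ Finset.Ioi i, a j i • X j = ∑ j, if i < j then a j i • X j else 0 := by
    rw [← Finset.sum_filter]; congr 1; ext; simp
  rw [W, h1, h2, ← Finset.sum_sub_distrib]
  refine Finset.sum_congr rfl fun j _ => ?_
  rw [wCoeff]
  rcases lt_trichotomy j i with h | h | h
  · simp [h, h.not_gt]
  · simp [h]
  · simp [h, h.not_gt]

theorem commSum_eq_sum (a : Fin m → Fin m → ℤ) :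
    commSum a = ∑ i, ∑ j, if j < i then a i j • ⁅X i, X j⁆ else 0 := by
  refine Finset.sum_congr rfl fun i _ => ?_
  rw [← Finset.sum_filter]; congr 1; ext; simp

theorem ι_sum_smul_X (c : Fin m → ℤ) :
    (ι ℤ (∑ j, c j • X j) : U (F m)) = ∑ j, c j • x j := by
  rw [map_sum]
  exact Finset.sum_congr rfl fun j _ => map_zsmul _ _ _

/-- Expanding `a_ij [X_i, X_j]`, the product starting with `X_i` goes into `X_i W_i` and the one
starting with `X_j` into `X_j W_j`, which accounts for the sign in `W`. -/
theorem ι_commSum (a : Fin m → Fin m → ℤ) :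
    (ι ℤ (commSum a) : U (F m)) = ∑ i, x i * ι ℤ (W a i) := by
  have h : ∀ i, (x i * ι ℤ (W a i) : U (F m)) =
      (∑ j, if j < i then a i j • (x i * x j) else 0) -
        ∑ j, if i < j then a j i • (x i * x j) else 0 := by
    intro i
    rw [W_eq_sum, ι_sum_smul_X, Finset.mul_sum, ← Finset.sum_sub_distrib]
    refine Finset.sum_congr rfl fun j _ => ?_
    rw [mul_smul_comm, wCoeff]
    rcases lt_trichotomy j i with h | h | h
    · simp [h, h.not_gt]
    · simp [h]
    · simp [h, h.not_gt]
  rw [Finset.sum_congr rfl fun i _ => h i, Finset.sum_sub_distrib]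
  rw [Finset.sum_comm (f := fun i j => if i < j then a j i • (x i * x j) else 0),
    ← Finset.sum_sub_distrib, commSum_eq_sum, map_sum]
  refine Finset.sum_congr rfl fun i _ => ?_
  rw [map_sum, ← Finset.sum_sub_distrib]
  refine Finset.sum_congr rfl fun j _ => ?_
  split_ifs with hij
  · rw [map_zsmul, ι_lie, smul_sub]; rfl
  · simp

theorem coeff_ι_sum_smul_X (c : Fin m → ℤ) (i : Fin m) (l : List (Fin m)) :
    coeff (i :: l) (ι ℤ (∑ j, c j • X j)) = c i * coeff l 1 := by
  rw [ι_sum_smul_X, map_sum, Finset.sum_eq_single i]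
  · rw [map_zsmul, coeff_cons_x, if_pos rfl, smul_eq_mul]
  · intro j _ hj
    rw [map_zsmul, coeff_cons_x, if_neg hj.symm, smul_zero]
  · simp

theorem coeff_cons_sum_x_mul (f : Fin m → U (F m)) (i : Fin m) (l : List (Fin m)) :
    coeff (i :: l) (∑ j, x j * f j) = coeff l (f i) := by
  simp

theorem coeff_cons_ι_commSum (a : Fin m → Fin m → ℤ) (i j : Fin m) (l : List (Fin m)) :
    coeff (i :: j :: l) (ι ℤ (commSum a)) = wCoeff a i j * coeff l 1 := by
  rw [ι_commSum, coeff_cons_sum_x_mul, W_eq_sum, coeff_ι_sum_smul_X]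

end linear

/-! ### Spanning sets for the quotients of the lower central series in weights one to three. -/

section spanning

/-- Modulo `γ_{n+2}` the bracket depends only on `u` modulo `γ_2` and on `v` modulo `γ_{n+1}`, so
bilinearity reduces the claim to the spanning sets. -/
theorem lie_mem_of_mem_span {n : ℕ} (hn : 1 ≤ n) {s t : Set (F m)} {T : Submodule ℤ (F m)}
    (hT : (gamma (F m) (n + 2)).toSubmodule ≤ T) (h : ∀ a ∈ s, ∀ b ∈ t, ⁅a, b⁆ ∈ T) {u v : F m}
    (hu : u ∈ Submodule.span ℤ s ⊔ (gamma (F m) 2).toSubmodule) (hvn : v ∈ gamma (F m) n)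
    (hv : v ∈ Submodule.span ℤ t ⊔ (gamma (F m) (n + 1)).toSubmodule) : ⁅u, v⁆ ∈ T := by
  obtain ⟨u₁, hu₁, u₂, hu₂, rfl⟩ := Submodule.mem_sup.1 hu
  obtain ⟨v₁, hv₁, v₂, hv₂, rfl⟩ := Submodule.mem_sup.1 hv
  rw [add_lie]
  refine T.add_mem ?_ (hT (lie_gamma_two_mem hn hu₂ hvn))
  rw [lie_add]
  refine T.add_mem ?_ (hT (lie_mem_gamma (by omega) hv₂ u₁))
  clear hu hv hvn
  induction hu₁ using Submodule.span_induction with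
  | mem a ha =>
    induction hv₁ using Submodule.span_induction with
    | mem b hb => exact h a ha b hb
    | zero => rw [lie_zero]; exact T.zero_mem
    | add b c _ _ hb hc => rw [lie_add]; exact T.add_mem hb hc
    | smul c b _ hb => rw [lie_smul]; exact T.smul_mem c hb
  | zero => rw [zero_lie]; exact T.zero_mem
  | add a b _ _ ha hb => rw [add_lie]; exact T.add_mem ha hb
  | smul c a _ ha => rw [smul_lie]; exact T.smul_mem c ha

theorem mem_span_X_sup_gamma_two (w : F m) :
    w ∈ Submodule.span ℤ (Set.range (X : Fin m → F m)) ⊔ (gamma (F m) 2).toSubmodule := by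
  let K : LieSubalgebra ℤ (F m) :=
    { Submodule.span ℤ (Set.range (X : Fin m → F m)) ⊔ (gamma (F m) 2).toSubmodule with
      lie_mem' := fun {u v} _ _ =>
        Submodule.mem_sup_right (lie_mem_gamma le_rfl (mem_gamma_one v) u) }
  exact lieSubalgebra_eq_top (K := K)
    (fun i => Submodule.mem_sup_left (Submodule.subset_span ⟨i, rfl⟩)) w

/-- The basic commutators of weight two, padded by zeros. -/
def basic₂ (p : Fin m × Fin m) : F m := if p.2 < p.1 then ⁅X p.1, X p.2⁆ else 0

/-- The basic commutators of weight three, padded by zeros. -/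
def basic₃ (p : Fin m × Fin m × Fin m) : F m :=
  if p.2.1 < p.1 ∧ p.2.1 ≤ p.2.2 then ⁅⁅X p.1, X p.2.1⁆, X p.2.2⁆ else 0

theorem lie_X_X_mem (i j : Fin m) : ⁅X i, X j⁆ ∈ Submodule.span ℤ (Set.range (basic₂ (m := m))) := by
  rcases lt_trichotomy j i with h | rfl | h
  · exact Submodule.subset_span ⟨(i, j), by simp [basic₂, h]⟩
  · rw [lie_self]; exact Submodule.zero_mem _
  · rw [← lie_skew]
    exact Submodule.neg_mem _ (Submodule.subset_span ⟨(j, i), by simp [basic₂, h]⟩)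

theorem lie_X_basic₂_mem (k : Fin m) (p : Fin m × Fin m) :
    ⁅X k, basic₂ p⁆ ∈ Submodule.span ℤ (Set.range (basic₃ (m := m))) := by
  obtain ⟨i, j⟩ := p
  have key : ∀ i j k : Fin m, j < i → j ≤ k →
      ⁅⁅X i, X j⁆, X k⁆ ∈ Submodule.span ℤ (Set.range (basic₃ (m := m))) := fun i j k h h' =>
    Submodule.subset_span ⟨(i, j, k), by simp [basic₃, h, h']⟩
  by_cases hij : j < i
  · have hb : basic₂ (i, j) = ⁅X i, X j⁆ := by simp [basic₂, hij]
    rw [hb]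
    rcases le_or_gt j k with h | h
    · rw [← lie_skew]; exact Submodule.neg_mem _ (key i j k hij h)
    -- When `k < j < i`, the Jacobi identity moves the smallest index `k` into the inner bracket.
    · have : (⁅X k, ⁅X i, X j⁆⁆ : F m) = ⁅⁅X j, X k⁆, X i⁆ - ⁅⁅X i, X k⁆, X j⁆ := by
        have h₁ : (⁅X k, X i⁆ : F m) = -⁅X i, X k⁆ := (lie_skew _ _).symm
        have h₂ : (⁅X i, ⁅X k, X j⁆⁆ : F m) = -⁅⁅X k, X j⁆, X i⁆ := (lie_skew _ _).symm
        have h₃ : (⁅X k, X j⁆ : F m) = -⁅X j, X k⁆ := (lie_skew _ _).symm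
        rw [leibniz_lie, h₂, h₁, h₃, neg_lie, neg_lie]
        abel
      rw [this]
      exact Submodule.sub_mem _ (key j k i h (h.trans hij).le) (key i k j (h.trans hij) h.le)
  · simp [basic₂, hij]

theorem mem_span_basic₂_sup_gamma_three {w : F m} (hw : w ∈ gamma (F m) 2) :
    w ∈ Submodule.span ℤ (Set.range (basic₂ (m := m))) ⊔ (gamma (F m) 3).toSubmodule := by
  refine gamma_succ_le (n := 1) le_rfl (fun u v hv => ?_) w hw
  refine lie_mem_of_mem_span (n := 1) le_rfl le_sup_right ?_ (mem_span_X_sup_gamma_two u) hv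
    (mem_span_X_sup_gamma_two v)
  rintro _ ⟨i, rfl⟩ _ ⟨j, rfl⟩
  exact Submodule.mem_sup_left (lie_X_X_mem i j)

theorem mem_span_basic₃_sup_gamma_four {w : F m} (hw : w ∈ gamma (F m) 3) :
    w ∈ Submodule.span ℤ (Set.range (basic₃ (m := m))) ⊔ (gamma (F m) 4).toSubmodule := by
  refine gamma_succ_le (n := 2) (by norm_num) (fun u v hv => ?_) w hw
  refine lie_mem_of_mem_span (n := 2) (by norm_num) le_sup_right ?_ (mem_span_X_sup_gamma_two u) hv
    (mem_span_basic₂_sup_gamma_three hv)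
  rintro _ ⟨i, rfl⟩ _ ⟨j, rfl⟩
  exact Submodule.mem_sup_left (lie_X_basic₂_mem i j)

theorem exists_sub_sum_X_mem (w : F m) : ∃ c : Fin m → ℤ, w - ∑ i, c i • X i ∈ gamma (F m) 2 := by
  obtain ⟨y, hy, z, hz, rfl⟩ := Submodule.mem_sup.1 (mem_span_X_sup_gamma_two w)
  obtain ⟨c, rfl⟩ := (Submodule.mem_span_range_iff_exists_fun ℤ).1 hy
  exact ⟨c, by rw [add_sub_cancel_left]; exact hz⟩

theorem exists_sub_commSum_mem {w : F m} (hw : w ∈ gamma (F m) 2) :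
    ∃ a : Fin m → Fin m → ℤ, w - commSum a ∈ gamma (F m) 3 := by
  obtain ⟨y, hy, z, hz, rfl⟩ := Submodule.mem_sup.1 (mem_span_basic₂_sup_gamma_three hw)
  obtain ⟨c, rfl⟩ := (Submodule.mem_span_range_iff_exists_fun ℤ).1 hy
  refine ⟨fun i j => c (i, j), ?_⟩
  have : ∑ p, c p • basic₂ p = commSum fun i j => c (i, j) := by
    rw [commSum_eq_sum, Fintype.sum_prod_type]
    simp only [basic₂, smul_ite, smul_zero]
  rw [← this, add_sub_cancel_left]; exact hz

theorem exists_sub_sum_basic₃_mem {w : F m} (hw : w ∈ gamma (F m) 3) :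
    ∃ b : Fin m × Fin m × Fin m → ℤ, w - ∑ p, b p • basic₃ p ∈ gamma (F m) 4 := by
  obtain ⟨y, hy, z, hz, rfl⟩ := Submodule.mem_sup.1 (mem_span_basic₃_sup_gamma_four hw)
  obtain ⟨c, rfl⟩ := (Submodule.mem_span_range_iff_exists_fun ℤ).1 hy
  exact ⟨c, by rw [add_sub_cancel_left]; exact hz⟩

end spanning

/-! ### Linear forms dual to the basic commutators of weight three. -/

section basic

theorem ι_basic₃ {p : Fin m × Fin m × Fin m} (hp : p.2.1 < p.1 ∧ p.2.1 ≤ p.2.2) :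
    (ι ℤ (basic₃ p) : U (F m)) = x p.1 * (x p.2.1 * x p.2.2) - x p.2.1 * (x p.1 * x p.2.2) -
      x p.2.2 * (x p.1 * x p.2.1) + x p.2.2 * (x p.2.1 * x p.1) := by
  rw [basic₃, if_pos hp, ι_lie, ι_lie]
  simp only [x]
  noncomm_ring

theorem coeff_ι_basic₃ (p : Fin m × Fin m × Fin m) (i j k : Fin m) :
    coeff [i, j, k] (ι ℤ (basic₃ p)) = if p.2.1 < p.1 ∧ p.2.1 ≤ p.2.2 then
      (if i = p.1 ∧ j = p.2.1 ∧ k = p.2.2 then 1 else 0) -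
      (if i = p.2.1 ∧ j = p.1 ∧ k = p.2.2 then 1 else 0) -
      (if i = p.2.2 ∧ j = p.1 ∧ k = p.2.1 then 1 else 0) +
      (if i = p.2.2 ∧ j = p.2.1 ∧ k = p.1 then 1 else 0) else 0 := by
  by_cases hp : p.2.1 < p.1 ∧ p.2.1 ≤ p.2.2
  · rw [if_pos hp, ι_basic₃ hp]
    simp [ite_and]
  · rw [if_neg hp, basic₃, if_neg hp, map_zero, map_zero]

/-- The linear form dual to the basic commutator indexed by `p`. -/
def dualForm (p : Fin m × Fin m × Fin m) : U (F m) →ₗ[ℤ] ℤ :=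
  if p.2.1 = p.2.2 then coeff [p.1, p.2.1, p.2.1]
  else coeff [p.1, p.2.1, p.2.2] + coeff [p.1, p.2.2, p.2.1]

/-- Let `q = (i', j', k')`. The two words of `basic₃ q` starting with `k'` have opposite signs and
differ by swapping the last two letters, so they cancel in the symmetrized form. The word starting
with `j'` starts with its least letter, whereas `dualForm p` reads words starting with `p.1 >
p.2.1`. Only `i'j'k'` survives, and the ordering of the last two indices forces `q = p`. -/
theorem dualForm_basic₃ {p : Fin m × Fin m × Fin m} (hp : p.2.1 < p.1 ∧ p.2.1 ≤ p.2.2)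
    (q : Fin m × Fin m × Fin m) : dualForm p (ι ℤ (basic₃ q)) = if q = p then 1 else 0 := by
  obtain ⟨i, j, k⟩ := p
  obtain ⟨i', j', k'⟩ := q
  simp only [Prod.mk.injEq] at hp ⊢
  by_cases hjk : j = k
  · subst hjk
    simp only [dualForm, if_true, coeff_ι_basic₃]
    grind (splits := 20)
  · simp only [dualForm, if_neg hjk, LinearMap.add_apply, coeff_ι_basic₃]
    grind (splits := 20)

theorem coeff_ι_basic₃_ne_zero {p : Fin m × Fin m × Fin m} {i j k : Fin m}
    (h : coeff [i, j, k] (ι ℤ (basic₃ p)) ≠ 0) :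
    (p.2.1 < p.1 ∧ p.2.1 ≤ p.2.2) ∧ (p.2.1 = i ∨ p.2.1 = j ∨ p.2.1 = k) := by
  rw [coeff_ι_basic₃] at h
  grind

end basic

variable {e : Fin m → ℕ} {ξ : Fin m → F m} {S : Set (F m)}

theorem relator_mem_relIdeal (i : Fin m) : (e i : ℤ) • X i + ξ i ∈ relIdeal e ξ S :=
  LieSubmodule.subset_lieSpan (Or.inl ⟨i, rfl⟩)

/-! ### The conditions imply membership. -/

section sufficiency

/-- The factor `e_i` moves onto `X_i`, where the relator trades `e_i X_i` for `-ξ_i ∈ γ_2`; the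
product with an element of `γ_2` then has degree four. -/
theorem x_mul_ι_mem_of_mem (hξ : ∀ i, ξ i ∈ gamma (F m) 2) (i : Fin m) {v : F m}
    (hv : v ∈ (e i : ℤ) • (gamma (F m) 2).toSubmodule ⊔
      (gamma (F m) 3).toSubmodule ⊔ (relIdeal e ξ S).toSubmodule) :
    x i * ι ℤ v ∈ augIdeal (F m) ^ 4 ⊔ envIdeal (F m) (relIdeal e ξ S) := by
  obtain ⟨y, hy, r, hr, rfl⟩ := Submodule.mem_sup.1 hv
  obtain ⟨s, hs, g, hg, rfl⟩ := Submodule.mem_sup.1 hy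
  obtain ⟨u, hu, rfl⟩ := (Submodule.mem_smul_pointwise_iff_exists _ _ _).1 hs
  have hx : (x i * ι ℤ ((e i : ℤ) • u) : U (F m)) =
      ι ℤ ((e i : ℤ) • X i + ξ i) * ι ℤ u - ι ℤ (ξ i) * ι ℤ u := by
    rw [map_add, map_zsmul, map_zsmul, add_mul, add_sub_cancel_right, smul_mul_assoc,
      mul_smul_comm]
    rfl
  rw [map_add, map_add, mul_add, mul_add, hx]
  refine add_mem (add_mem (sub_mem ?_ ?_) ?_) ?_
  · exact Submodule.mem_sup_right
      (mul_mem_envIdeal_right (ι_mem_envIdeal (relator_mem_relIdeal i)) _)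
  · have h := Submodule.mul_mem_mul (ι_mem_augIdeal_pow (by norm_num) _ (hξ i))
      (ι_mem_augIdeal_pow (by norm_num) _ hu)
    rw [← Submodule.pow_add _ (by norm_num)] at h
    exact Submodule.mem_sup_left h
  · have h := Submodule.mul_mem_mul (ι_mem_augIdeal (X i))
      (ι_mem_augIdeal_pow (by norm_num) _ hg)
    rw [← Submodule.pow_succ' _ (by norm_num)] at h
    exact Submodule.mem_sup_left h
  · exact Submodule.mem_sup_right (Ideal.mul_mem_left _ _ (ι_mem_envIdeal hr))

theorem ι_mem_of_mem_gamma_sup {v : F m} (hv : v ∈ gamma (F m) 4 ⊔ relIdeal e ξ S) :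
    ι ℤ v ∈ augIdeal (F m) ^ 4 ⊔ envIdeal (F m) (relIdeal e ξ S) := by
  obtain ⟨g, hg, r, hr, rfl⟩ := (LieSubmodule.mem_sup _ _ _).1 hv
  rw [map_add]
  exact add_mem (Submodule.mem_sup_left (ι_mem_augIdeal_pow (by norm_num) _ hg))
    (Submodule.mem_sup_right (ι_mem_envIdeal hr))

end sufficiency

/-! ### Reduction modulo cubic terms with divisible coefficients. -/

section congruences

theorem lie_mem_gamma_sup {n : ℕ} (hn : 1 ≤ n) {R : LieIdeal ℤ (F m)} {v : F m}
    (hv : v ∈ gamma (F m) n ⊔ R) (u : F m) : ⁅u, v⁆ ∈ gamma (F m) (n + 1) ⊔ R := by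
  obtain ⟨g, hg, r, hr, rfl⟩ := (LieSubmodule.mem_sup _ _ _).1 hv
  rw [lie_add]
  exact (LieSubmodule.mem_sup _ _ _).2 ⟨_, lie_mem_gamma hn hg u, _, R.lie_mem hr, rfl⟩

/-- `e_j [u, X_j] = [u, e_j X_j + ξ_j] - [u, ξ_j]`, where the first bracket is in `R` and the second
in `γ_3`. -/
theorem smul_lie_mem_of_dvd (hξ : ∀ i, ξ i ∈ gamma (F m) 2) {j : Fin m} {c : ℤ}
    (hc : (e j : ℤ) ∣ c) (u : F m) :
    c • ⁅u, X j⁆ ∈ gamma (F m) 3 ⊔ relIdeal e ξ S := by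
  obtain ⟨d, rfl⟩ := hc
  have h : ((e j : ℤ) * d) • (⁅u, X j⁆ : F m) =
      d • (-⁅u, ξ j⁆) + d • ⁅u, (e j : ℤ) • X j + ξ j⁆ := by
    have hs : (⁅u, (e j : ℤ) • X j⁆ : F m) = (e j : ℤ) • ⁅u, X j⁆ := lie_zsmul _ _ _
    rw [lie_add, hs, mul_comm, mul_smul, smul_add, smul_neg]
    abel
  rw [h]
  exact (LieSubmodule.mem_sup _ _ _).2
    ⟨_, zsmul_mem (neg_mem (lie_mem_gamma (by norm_num) (hξ j) u)) d,
      _, zsmul_mem ((relIdeal e ξ S).lie_mem (relator_mem_relIdeal j)) d, rfl⟩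

theorem smul_basic₃_mem_of_dvd (hξ : ∀ i, ξ i ∈ gamma (F m) 2) {p : Fin m × Fin m × Fin m} {c : ℤ}
    (hc : (p.2.1 < p.1 ∧ p.2.1 ≤ p.2.2) → (e p.2.1 : ℤ) ∣ c) :
    c • basic₃ p ∈ gamma (F m) 4 ⊔ relIdeal e ξ S := by
  by_cases hp : p.2.1 < p.1 ∧ p.2.1 ≤ p.2.2
  · have h := lie_mem_gamma_sup (by norm_num) (smul_lie_mem_of_dvd (S := S) hξ (hc hp) (X p.1))
      (X p.2.2)
    have h' : c • (⁅⁅X p.1, X p.2.1⁆, X p.2.2⁆ : F m) = -⁅X p.2.2, c • ⁅X p.1, X p.2.1⁆⁆ := by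
      rw [lie_skew]; exact (zsmul_lie _ _ _).symm
    rw [basic₃, if_pos hp, h']
    exact neg_mem h
  · rw [basic₃, if_neg hp, smul_zero]
    exact zero_mem _

/-- The linear coefficients of a relation are divisible by the numbers `e_j`. -/
theorem dvd_coeff_of_mem_relIdeal (hξ : ∀ i, ξ i ∈ gamma (F m) 2)
    (hS : ∀ η ∈ S, η ∈ gamma (F m) 2) {r : F m} (hr : r ∈ relIdeal e ξ S) (j : Fin m) :
    (e j : ℤ) ∣ coeff [j] (ι ℤ r) := by
  let K : LieIdeal ℤ (F m) :=
    { carrier := {r | ∀ j, (e j : ℤ) ∣ coeff [j] (ι ℤ r)}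
      add_mem' := fun {a b} ha hb j => by
        rw [map_add, map_add]; exact dvd_add (ha j) (hb j)
      zero_mem' := fun j => by rw [map_zero, map_zero]; exact dvd_zero _
      smul_mem' := fun c a ha j => by
        rw [map_zsmul, map_zsmul, smul_eq_mul]; exact Dvd.dvd.mul_left (ha j) c
      -- A bracket has no linear terms, so the condition need only be checked on the generators of
      -- `R`.
      lie_mem := fun {u v} _ j => by
        rw [coeff_ι_gamma (n := 2) (by norm_num) (lie_mem_gamma le_rfl (mem_gamma_one v) u) [j]
          (by simp)]
        exact dvd_zero _ }
  have hγ : ∀ v ∈ gamma (F m) 2, ∀ j, coeff [j] (ι ℤ v) = 0 := fun v hv j =>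
    coeff_ι_gamma (by norm_num) hv [j] (by simp)
  have hK : relIdeal e ξ S ≤ K := by
    refine LieSubmodule.lieSpan_le.2 ?_
    rintro _ (⟨i, rfl⟩ | hη) j
    · change (e j : ℤ) ∣ coeff [j] (ι ℤ ((e i : ℤ) • X i + ξ i))
      rw [map_add, map_add, hγ _ (hξ i), add_zero, map_zsmul, map_zsmul]
      change (e j : ℤ) ∣ (e i : ℤ) • coeff [j] (x i)
      rw [coeff_cons_x]
      split_ifs with h
      · subst h; simp
      · simp
    · rw [hγ _ (hS _ hη)]; exact dvd_zero _
  exact hK hr j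

theorem ι_mem_order_one (u : F m) : ι ℤ u ∈ order m 1 := fun l hl =>
  coeff_ι_gamma le_rfl (mem_gamma_one u) l hl

/-- The elements without words of length `< 3` in which `e_k` divides the coefficient of
`X_i X_j X_k`. -/
def cubic (e : Fin m → ℕ) : Submodule ℤ (U (F m)) where
  carrier := {z | z ∈ order m 3 ∧ ∀ i j k, (e k : ℤ) ∣ coeff [i, j, k] z}
  add_mem' {a b} ha hb := ⟨add_mem ha.1 hb.1, fun i j k => by
    rw [map_add]; exact dvd_add (ha.2 i j k) (hb.2 i j k)⟩
  zero_mem' := ⟨zero_mem _, fun i j k => by rw [map_zero]; exact dvd_zero _⟩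
  smul_mem' c a ha := ⟨zsmul_mem ha.1 c, fun i j k => by
    rw [map_zsmul, smul_eq_mul]; exact Dvd.dvd.mul_left (ha.2 i j k) c⟩

theorem order_four_le_cubic {z : U (F m)} (hz : z ∈ order m 4) : z ∈ cubic e :=
  ⟨order_antitone (by norm_num) hz, fun i j k => by rw [hz [i, j, k] (by simp)]; exact dvd_zero _⟩

/-- The product has no words of length below four, so the divisibility condition becomes vacuous. -/
theorem x_mul_mem_cubic {z : U (F m)} (hz : z ∈ cubic e) (i : Fin m) : x i * z ∈ cubic e :=
  order_four_le_cubic (x_mul_mem_order hz.1 i)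

theorem x_mul_x_mul_mem_cubic {r : F m} (hr : ∀ k, (e k : ℤ) ∣ coeff [k] (ι ℤ r)) (i j : Fin m) :
    x i * (x j * ι ℤ r) ∈ cubic e := by
  refine ⟨x_mul_mem_order (x_mul_mem_order (ι_mem_order_one r) j) i, fun i' j' k => ?_⟩
  rw [coeff_cons_x_mul, coeff_cons_x_mul]
  split_ifs
  · exact hr k
  · exact dvd_zero _
  · exact dvd_zero _

/-- The elements congruent, modulo `cubic e`, to a member of `R + ∑ X_i R`. -/
def approx (e : Fin m → ℕ) (R : LieIdeal ℤ (F m)) : Submodule ℤ (U (F m)) where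
  carrier := {z | ∃ r₀ ∈ R, ∃ r : Fin m → F m, (∀ i, r i ∈ R) ∧
    z - ι ℤ r₀ - ∑ i, x i * ι ℤ (r i) ∈ cubic e}
  add_mem' := by
    rintro a b ⟨r₀, h₀, r, hr, h⟩ ⟨s₀, h₀', s, hs, h'⟩
    refine ⟨r₀ + s₀, add_mem h₀ h₀', r + s, fun i => add_mem (hr i) (hs i), ?_⟩
    have hsum : ∑ i, x i * ι ℤ ((r + s) i) =
        ∑ i, x i * ι ℤ (r i) + ∑ i, x i * (ι ℤ (s i) : U (F m)) := by
      rw [← Finset.sum_add_distrib]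
      exact Finset.sum_congr rfl fun i _ => by rw [Pi.add_apply, map_add, mul_add]
    rw [hsum, map_add]
    convert add_mem h h' using 1
    abel
  zero_mem' := ⟨0, zero_mem _, 0, fun _ => zero_mem _, by simp⟩
  smul_mem' := by
    rintro c a ⟨r₀, h₀, r, hr, h⟩
    refine ⟨c • r₀, zsmul_mem h₀ c, fun i => c • r i, fun i => zsmul_mem (hr i) c, ?_⟩
    have hsum : ∑ i, x i * (ι ℤ (c • r i) : U (F m)) = c • ∑ i, x i * ι ℤ (r i) := by
      rw [Finset.smul_sum]
      exact Finset.sum_congr rfl fun i _ => by rw [map_zsmul, mul_smul_comm]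
    rw [hsum, map_zsmul, ← smul_sub, ← smul_sub]
    exact zsmul_mem h c

theorem x_mul_mem_approx {R : LieIdeal ℤ (F m)}
    (hR : ∀ r ∈ R, ∀ k, (e k : ℤ) ∣ coeff [k] (ι ℤ r)) (j : Fin m) {z : U (F m)}
    (hz : z ∈ approx e R) : x j * z ∈ approx e R := by
  obtain ⟨r₀, h₀, r, hr, h⟩ := hz
  -- Multiplication by `x j` turns `r₀` into the new term at index `j`; the old terms become `x j *
  -- x i * r i`, which lie in `cubic e`.
  refine ⟨0, zero_mem _, Pi.single j r₀, fun i => ?_, ?_⟩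
  · by_cases hij : i = j
    · subst hij; rwa [Pi.single_eq_same]
    · rw [Pi.single_eq_of_ne hij]; exact zero_mem _
  · have hsum : ∑ i, x i * (ι ℤ ((Pi.single j r₀ : Fin m → F m) i) : U (F m)) = x j * ι ℤ r₀ := by
      rw [Finset.sum_eq_single j, Pi.single_eq_same]
      · intro i _ hij; rw [Pi.single_eq_of_ne hij, map_zero, mul_zero]
      · simp
    have hz : x j * z - ι ℤ 0 - x j * ι ℤ r₀ =
        x j * (z - ι ℤ r₀ - ∑ i, x i * ι ℤ (r i)) + ∑ i, x j * (x i * ι ℤ (r i)) := by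
      rw [map_zero, sub_zero, mul_sub, mul_sub, Finset.mul_sum]; abel
    rw [hsum, hz]
    exact add_mem (x_mul_mem_cubic h j)
      (sum_mem fun i _ => x_mul_x_mul_mem_cubic (hR _ (hr i)) j i)

theorem mem_approx {R : LieIdeal ℤ (F m)}
    (hR : ∀ r ∈ R, ∀ k, (e k : ℤ) ∣ coeff [k] (ι ℤ r)) {z : U (F m)}
    (hz : z ∈ augIdeal (F m) ^ 4 ⊔ envIdeal (F m) R) : z ∈ approx e R := by
  obtain ⟨a, ha, b, hb, rfl⟩ := Submodule.mem_sup.1 hz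
  refine add_mem ?_ ?_
  · refine ⟨0, zero_mem _, 0, fun _ => zero_mem _, ?_⟩
    have : a ∈ cubic e := order_four_le_cubic (augIdeal_pow_le_order (by norm_num) ha)
    simpa using this
  · clear hz
    rw [envIdeal_eq_span] at hb
    induction hb using Submodule.span_induction with
    | mem y hy =>
      obtain ⟨u, hu, rfl⟩ := hy
      exact ⟨u, hu, 0, fun _ => zero_mem _, by simp⟩
    | zero => exact zero_mem _
    | add a b _ _ ha hb => exact add_mem ha hb
    | smul c a _ ha => exact mul_mem_of_x_mul_mem (fun i _ h => x_mul_mem_approx hR i h) c a ha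

end congruences

/-! ### Comparison of coefficients and the necessity of the conditions. -/

section comparison

theorem coeff_ι_of_sub_mem_gamma {n : ℕ} (hn : 1 ≤ n) {u v : F m} (h : u - v ∈ gamma (F m) n)
    (l : List (Fin m)) (hl : l.length < n) : coeff l (ι ℤ u) = coeff l (ι ℤ v) := by
  have := coeff_ι_gamma hn h l hl
  rwa [map_sub, map_sub, sub_eq_zero] at this

theorem wCoeff_swap (a : Fin m → Fin m → ℤ) (i j : Fin m) : wCoeff a i j = -wCoeff a j i := by
  rcases lt_trichotomy i j with h | rfl | h <;> simp [wCoeff, *, not_lt_of_gt]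

/-- A tensor of degree three that is divisible, up to an alternating part, pairs divisibly with the
basic commutators. -/
theorem dvd_dualForm (he : ∀ i j : Fin m, i ≤ j → e i ∣ e j) {z : U (F m)}
    {d : Fin m → Fin m → Fin m → ℤ}
    (h : ∀ i j k, (e k : ℤ) ∣ coeff [i, j, k] z - wCoeff (d i) j k)
    {p : Fin m × Fin m × Fin m} (hp : p.2.1 ≤ p.2.2) : (e p.2.1 : ℤ) ∣ dualForm p z := by
  obtain ⟨i, j, k⟩ := p
  by_cases hjk : j = k
  · subst hjk
    have := h i j j
    have h0 : wCoeff (d i) j j = 0 := by simp [wCoeff]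
    rw [h0, sub_zero] at this
    simpa [dualForm] using this
  -- The congruences at `ijk` and `ikj` hold modulo `e_k` and `e_j`; since `e_j ∣ e_k`, both hold
  -- modulo `e_j`, and their sum cancels the alternating part.
  · have h₁ := (Int.natCast_dvd_natCast.2 (he j k hp)).trans (h i j k)
    have h₂ := dvd_add h₁ (h i k j)
    rw [wCoeff_swap (d i) k j] at h₂
    simp only [dualForm, if_neg hjk, LinearMap.add_apply]
    rwa [sub_neg_eq_add, sub_add_add_cancel] at h₂

theorem dualForm_sum_basic₃ (b : Fin m × Fin m × Fin m → ℤ) {p : Fin m × Fin m × Fin m}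
    (hp : p.2.1 < p.1 ∧ p.2.1 ≤ p.2.2) : dualForm p (ι ℤ (∑ q, b q • basic₃ q)) = b p := by
  rw [map_sum, map_sum, Finset.sum_eq_single p]
  · rw [map_zsmul, map_zsmul, dualForm_basic₃ hp, if_pos rfl, smul_eq_mul, mul_one]
  · intro q _ hq
    rw [map_zsmul, map_zsmul, dualForm_basic₃ hp, if_neg hq, smul_zero]
  · simp

/-- A basic commutator contributing to the word `ijk` has its least index among `i, j, k`, hence at
least `t`, so `e_t` divides its coefficient through the divisibility chain. -/
theorem dvd_coeff_sum_basic₃ (he : ∀ i j : Fin m, i ≤ j → e i ∣ e j)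
    {b : Fin m × Fin m × Fin m → ℤ}
    (hb : ∀ p, (p.2.1 < p.1 ∧ p.2.1 ≤ p.2.2) → (e p.2.1 : ℤ) ∣ b p)
    {t i j k : Fin m} (hi : t ≤ i) (hj : t ≤ j) (hk : t ≤ k) :
    (e t : ℤ) ∣ coeff [i, j, k] (ι ℤ (∑ q, b q • basic₃ q)) := by
  rw [map_sum, map_sum]
  refine Finset.dvd_sum fun p _ => ?_
  rw [map_zsmul, map_zsmul, smul_eq_mul]
  by_cases h : coeff [i, j, k] (ι ℤ (basic₃ p)) = 0
  · rw [h, mul_zero]; exact dvd_zero _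
  · obtain ⟨hp, hq⟩ := coeff_ι_basic₃_ne_zero h
    refine Dvd.dvd.mul_right ((Int.natCast_dvd_natCast.2 (he t _ ?_)).trans (hb p hp)) _
    rcases hq with hq | hq | hq <;> rw [hq] <;> assumption

theorem commSum_mem {T : Submodule ℤ (F m)} {d : Fin m → Fin m → ℤ}
    (h : ∀ j k, k < j → d j k • ⁅X j, X k⁆ ∈ T) : commSum d ∈ T :=
  sum_mem fun j _ => sum_mem fun k hk => h j k (Finset.mem_Iio.1 hk)

theorem necessity (he : ∀ i j : Fin m, i ≤ j → e i ∣ e j) (hξ : ∀ i, ξ i ∈ gamma (F m) 2)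
    (hS : ∀ η ∈ S, η ∈ gamma (F m) 2) {w : F m}
    (hw : ι ℤ w ∈ augIdeal (F m) ^ 4 ⊔ envIdeal (F m) (relIdeal e ξ S)) :
    ∃ a : Fin m → Fin m → ℤ,
      (∀ i j, j < i → (e i : ℤ) ∣ a i j) ∧
      (∀ i, W a i ∈ (e i : ℤ) • (gamma (F m) 2).toSubmodule ⊔
        (gamma (F m) 3).toSubmodule ⊔ (relIdeal e ξ S).toSubmodule) ∧
      w - commSum a ∈ gamma (F m) 4 ⊔ relIdeal e ξ S := by
  have hR : ∀ r ∈ relIdeal e ξ S, ∀ k, (e k : ℤ) ∣ coeff [k] (ι ℤ r) := fun r hr k =>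
    dvd_coeff_of_mem_relIdeal hξ hS hr k
  obtain ⟨r₀, hr₀, r, hr, hz⟩ := mem_approx hR hw
  rw [← map_sub] at hz
  set v := w - r₀ with hv
  obtain ⟨hz3, hze⟩ := hz
  have hlow : ∀ i l, l.length < 2 → coeff (i :: l) (ι ℤ v) = coeff l (ι ℤ (r i)) := by
    intro i l hl
    have := hz3 (i :: l) (by rw [List.length_cons]; omega)
    rwa [map_sub, coeff_cons_sum_x_mul, sub_eq_zero] at this
  have hcub : ∀ i j k, (e k : ℤ) ∣ coeff [i, j, k] (ι ℤ v) - coeff [j, k] (ι ℤ (r i)) := by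
    intro i j k
    have := hze i j k
    rwa [map_sub, coeff_cons_sum_x_mul] at this
  have hv2 : v ∈ gamma (F m) 2 := by
    obtain ⟨c, hc⟩ := exists_sub_sum_X_mem v
    have h0 : ∀ i, c i = 0 := by
      intro i
      have h1 := coeff_ι_of_sub_mem_gamma (by norm_num) hc [i] (by simp)
      rw [hlow i [] (by simp), ι_mem_order_one (r i) [] (by simp), coeff_ι_sum_smul_X,
        coeff_nil_one, mul_one] at h1
      exact h1.symm
    simpa [h0] using hc
  obtain ⟨a, ha⟩ := exists_sub_commSum_mem hv2
  obtain ⟨b, hb⟩ := exists_sub_sum_basic₃_mem ha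
  -- Here `g` is the weight-three part of `v`; `n i` and `d i` below record the linear and quadratic
  -- parts of `r i`.
  set g := ∑ p, b p • basic₃ p with hg
  choose n hn using fun i => exists_sub_sum_X_mem (r i)
  choose d hd using fun i => exists_sub_commSum_mem (hn i)
  have hrn : ∀ i j, coeff [j] (ι ℤ (r i)) = n i j := by
    intro i j
    rw [coeff_ι_of_sub_mem_gamma (by norm_num) (hn i) [j] (by simp), coeff_ι_sum_smul_X,
      coeff_nil_one, mul_one]
  have hrd : ∀ i j k, coeff [j, k] (ι ℤ (r i)) = wCoeff (d i) j k := by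
    intro i j k
    have := coeff_ι_of_sub_mem_gamma (by norm_num) (hd i) [j, k] (by simp)
    rw [map_sub, map_sub, coeff_ι_sum_smul_X, coeff_cons_one, mul_zero, sub_zero,
      coeff_cons_ι_commSum, coeff_nil_one, mul_one] at this
    exact this
  have han : ∀ i j, wCoeff a i j = n i j := by
    intro i j
    have := coeff_ι_of_sub_mem_gamma (by norm_num) ha [i, j] (by simp)
    rw [hlow i [j] (by simp), hrn, coeff_cons_ι_commSum, coeff_nil_one, mul_one] at this
    exact this.symm
  have hgd : ∀ i j k, (e k : ℤ) ∣ coeff [i, j, k] (ι ℤ g) - wCoeff (d i) j k := by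
    intro i j k
    have := coeff_ι_of_sub_mem_gamma (by norm_num) hb [i, j, k] (by simp)
    rw [map_sub, map_sub, coeff_cons_ι_commSum, coeff_cons_one, mul_zero, sub_zero] at this
    rw [← this, ← hrd]
    exact hcub i j k
  have hbe : ∀ p : Fin m × Fin m × Fin m, (p.2.1 < p.1 ∧ p.2.1 ≤ p.2.2) → (e p.2.1 : ℤ) ∣ b p := by
    intro p hp
    rw [← dualForm_sum_basic₃ b hp]
    exact dvd_dualForm he hgd hp.2
  refine ⟨a, fun i j hij => ?_, fun i => ?_, ?_⟩
  -- Up to sign, `a i j` is the coefficient of `X_i` in the relation `r j`.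
  · have h : a i j = -wCoeff a j i := by simp [wCoeff, hij, hij.not_gt]
    rw [h, han, ← hrn, dvd_neg]
    exact hR _ (hr j) i
  -- `W a i` is the linear part of `r i`, so modulo `R` and `γ_3` only the quadratic part of `r i`
  -- has to be controlled.
  · have hW : W a i = -commSum (d i) - (r i - ∑ j, n i j • X j - commSum (d i)) + r i := by
      rw [W_eq_sum, Finset.sum_congr rfl fun j _ => by rw [han i j]]
      abel
    rw [hW]
    have hsup : ∀ y ∈ gamma (F m) 3 ⊔ relIdeal e ξ S, y ∈ (e i : ℤ) • (gamma (F m) 2).toSubmodule ⊔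
        (gamma (F m) 3).toSubmodule ⊔ (relIdeal e ξ S).toSubmodule := by
      intro y hy
      obtain ⟨s, hs, t, ht, rfl⟩ := (LieSubmodule.mem_sup _ _ _).1 hy
      exact add_mem (Submodule.mem_sup_left (Submodule.mem_sup_right hs))
        (Submodule.mem_sup_right ht)
    refine add_mem (sub_mem (neg_mem (commSum_mem fun j k hkj => ?_))
      (Submodule.mem_sup_left (Submodule.mem_sup_right (hd i)))) (Submodule.mem_sup_right (hr i))
    obtain ⟨s, hs⟩ := hgd i j k
    have hd' : d i j k = coeff [i, j, k] (ι ℤ g) - e k * s := by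
      rw [← hs]; simp [wCoeff, hkj]
    rw [hd', sub_smul]
    refine sub_mem ?_ (hsup _ (smul_lie_mem_of_dvd hξ (dvd_mul_right _ _) _))
    -- Here `k < j`. If `k ≤ i`, then `k` is the least index, so `e_k` divides the coefficient and
    -- the term falls into `γ_3 + R`. If `i < k`, then `i` is the least and the term falls into `e_i
    -- γ_2`.
    rcases le_or_gt k i with hki | hik
    · exact hsup _ (smul_lie_mem_of_dvd hξ (dvd_coeff_sum_basic₃ he hbe hki hkj.le le_rfl) _)
    · obtain ⟨c, hc⟩ := dvd_coeff_sum_basic₃ he hbe le_rfl (hik.trans hkj).le hik.le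
      rw [hg, hc, mul_smul]
      exact Submodule.mem_sup_left (Submodule.mem_sup_left (Submodule.smul_mem_pointwise_smul _ _ _
        (zsmul_mem (lie_mem_gamma le_rfl (mem_gamma_one (X k)) (X j)) c)))
  · have hwv : w - commSum a = v - commSum a - g + g + r₀ := by rw [hv]; abel
    rw [hwv]
    exact add_mem (add_mem ((le_sup_left : _ ≤ gamma (F m) 4 ⊔ relIdeal e ξ S) hb)
      (sum_mem fun p _ => smul_basic₃_mem_of_dvd hξ (hbe p)))
      ((le_sup_right : _ ≤ gamma (F m) 4 ⊔ relIdeal e ξ S) hr₀)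

end comparison

end LieDim
end

open LieDim in
theorem mainTheorem3 (m : ℕ) (e : Fin m → ℕ) (he : ∀ i j : Fin m, i ≤ j → e i ∣ e j)
    (ξ : Fin m → F m) (hξ : ∀ i, ξ i ∈ gamma (F m) 2)
    (S : Set (F m)) (hS : ∀ η ∈ S, η ∈ gamma (F m) 2) (w : F m) :
    w ∈ interLie (F m) (augIdeal (F m) ^ 4 ⊔ envIdeal (F m) (relIdeal e ξ S)) ↔
      ∃ a : Fin m → Fin m → ℤ,
        (∀ i j, j < i → (e i : ℤ) ∣ a i j) ∧
        (∀ i, W a i ∈ (e i : ℤ) • (gamma (F m) 2).toSubmodule ⊔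
          (gamma (F m) 3).toSubmodule ⊔ (relIdeal e ξ S).toSubmodule) ∧
        w - commSum a ∈ gamma (F m) 4 ⊔ relIdeal e ξ S := by
  refine ⟨fun hw => necessity he hξ hS hw, ?_⟩
  rintro ⟨a, -, hW, hw⟩
  change UniversalEnvelopingAlgebra.ι ℤ w ∈
    augIdeal (F m) ^ 4 ⊔ envIdeal (F m) (relIdeal e ξ S)
  rw [← sub_add_cancel w (commSum a), map_add, ι_commSum]
  exact add_mem (ι_mem_of_mem_gamma_sup hw)
    (sum_mem fun i _ => x_mul_ι_mem_of_mem hξ i (hW i))
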